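/- Let $n \ge 2$ and let $s$ be the common order of the weights. A weighted graph on $\{1,\dots,n\}$ is a simple undirected graph, each edge $(i,j)$ of which carries a real symmetric positive definite $s\times s$ matrix $W_{ij}=W_{ji}$ as weight. Let $T$ be a weighted tree on $\{1,\dots,n\}$, and let $D=[D_{ij}]$ be its distance matrix: the $ns\times ns$ block matrix whose block $D_{ij}$ is the sum of the weights of the edges on the path joining $i$ and $j$ in $T$, with $D_{ii}=0$. Let $G$ be any connected weighted graph on $\{1,\dots,n\}$, with weights of order $s$ as well, and let $L=[L_{ij}]$ be its Laplacian: $L_{ij}=-W_{ij}^{-1}$ if $i\neq j$ are adjacent in $G$, $L_{ij}=0$ if $i\ne j$ are not adjacent, and $L_{ii}$ is the sum of $W_{ik}^{-1}$ over the neighbours $k$ of $i$, where the $W_{ij}$ are now the weights of $G$. Let $U$ be the $ns\times s$ matrix $(I_s,\dots,I_s)'$, and let $J$ be the $ns\times ns$ block matrix with each block equal to $I_s$. Write the inertia of a symmetric matrix $A$ as $\mathrm{In}(A)=(n_-(A),n_z(A),n_+(A))$, where $n_-(A)$ and $n_+(A)$ are the numbers of negative and positive eigenvalues counted with multiplicity,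 and $n_z(A)$ is the nullity. Then $D$ is nonsingular, and for every real $\beta\ge 0$ the following hold. (i) $D^{-1}-\beta L$ is nonsingular. (ii) $D^{-1}-\beta L$ is symmetric and $\mathrm{In}(D^{-1}-\beta L)=(ns-s,0,s)$. (iii) For every $i\in\{1,\dots,n\}$, the principal block submatrix of $D^{-1}-\beta L$ obtained by deleting the $i$-th block row and block column is negative definite if $\beta>0$, and negative semidefinite if $\beta=0$. (iv) The bordered matrix $\begin{pmatrix}(D^{-1}-\beta L)^{-1} & U\\ U' & 0\end{pmatrix}$ is nonsingular and has exactly $s$ positive eigenvalues, counted with multiplicity. (v) $(D^{-1}-\beta L)^{-1}$ is negative semidefinite on the null space of $J$: $x'(D^{-1}-\beta L)^{-1}x\le 0$ for all $x\in\mathbb{R}^{ns}$ with $Jx=0$. (vi) Every $s\times s$ block $B$ of $(D^{-1}-L)^{-1}$ is positive definite, in the sense that $x'Bx>0$ for all nonzero $x\in\mathbb{R}^s$ (the off-diagonal blocks need not be symmetric). -/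

import Mathlib

open scoped Matrix

/-- A weighted graph on the vertices `0, …, n - 1`: a finite simple undirected graph, each edge of
which carries a (symmetric) positive definite real matrix of order `s`. The values of `weight` on
pairs that are not edges are never used. -/
structure WeightedGraph (n s : ℕ) where
  graph : SimpleGraph (Fin n)
  weight : Sym2 (Fin n) → Matrix (Fin s) (Fin s) ℝ
  weight_posDef : ∀ e ∈ graph.edgeSet, (weight e).PosDef

/-- The `ns × ns` matrix whose `(i, j)` block is the `s × s` matrix `B i j`. -/
def ofBlocks {n s : ℕ} (B : Fin n → Fin n → Matrix (Fin s) (Fin s) ℝ) :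
    Matrix (Fin n × Fin s) (Fin n × Fin s) ℝ :=
  Matrix.of fun p q => B p.1 q.1 p.2 q.2

/-- The `(i, j)` block of an `ns × ns` block matrix. -/
def blockAt {n s : ℕ} (A : Matrix (Fin n × Fin s) (Fin n × Fin s) ℝ) (i j : Fin n) :
    Matrix (Fin s) (Fin s) ℝ :=
  Matrix.of fun a b => A (i, a) (j, b)

/-- The principal block submatrix of `A` on the block rows and block columns in `Δ`. -/
def principalBlocks {n s : ℕ} (A : Matrix (Fin n × Fin s) (Fin n × Fin s) ℝ)
    (Δ : Finset (Fin n)) : Matrix (Δ × Fin s) (Δ × Fin s) ℝ :=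
  Matrix.of fun p q => A (p.1, p.2) (q.1, q.2)

namespace WeightedGraph

variable {n s : ℕ} (G : WeightedGraph n s)

open Classical in
/-- The inverse of the weight of the edge `{i, j}`; the null matrix if `i, j` are not adjacent. -/
noncomputable def invWeight (i j : Fin n) : Matrix (Fin s) (Fin s) ℝ :=
  if G.graph.Adj i j then (G.weight s(i, j))⁻¹ else 0

/-- The block Laplacian. -/
noncomputable def laplacian : Matrix (Fin n × Fin s) (Fin n × Fin s) ℝ :=
  ofBlocks fun i j => if i = j then ∑ k, G.invWeight i k else -G.invWeight i j

/-- The sum of the weights of the edges of a walk. -/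
def walkWeight {i j : Fin n} (p : G.graph.Walk i j) : Matrix (Fin s) (Fin s) ℝ :=
  (p.edges.map G.weight).sum

/-- The distance between two vertices of a weighted tree: the sum of the weights lying in the
path that connects them, and the null matrix if the vertices coincide. -/
noncomputable def treeDist (hG : G.graph.IsTree) (i j : Fin n) : Matrix (Fin s) (Fin s) ℝ :=
  if i = j then 0 else G.walkWeight (hG.existsUnique_path i j).choose

/-- The block distance matrix of a weighted tree. -/
noncomputable def distMatrix (hG : G.graph.IsTree) :
    Matrix (Fin n × Fin s) (Fin n × Fin s) ℝ :=
  ofBlocks (G.treeDist hG)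

theorem treeDist_eq_walkWeight (hG : G.graph.IsTree) {i j : Fin n} (p : G.graph.Walk i j)
    (hp : p.IsPath) : G.treeDist hG i j = G.walkWeight p := by
  have h := (hG.existsUnique_path i j).choose_spec
  have hpe : p = (hG.existsUnique_path i j).choose := h.2 p hp
  unfold treeDist
  split_ifs with hij
  · subst hij
    have : p = SimpleGraph.Walk.nil := (SimpleGraph.Walk.isPath_iff_nil.1 hp).eq_nil
    simp [this, walkWeight]
  · rw [← hpe]

end WeightedGraph

/-- The `ns × s` matrix `U = e ⊗ I_s`, a column of `n` identity matrices. -/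
def blockOnes (n s : ℕ) : Matrix (Fin n × Fin s) (Fin s) ℝ :=
  Matrix.of fun p b => (1 : Matrix (Fin s) (Fin s) ℝ) p.2 b

/-- The `ns × ns` matrix `J`, each block of which is the identity `I_s`. -/
def blockJ (n s : ℕ) : Matrix (Fin n × Fin s) (Fin n × Fin s) ℝ :=
  ofBlocks fun _ _ => 1

/-- The number of negative eigenvalues, with multiplicity (used for symmetric matrices). -/
noncomputable def numNegEigenvalues {m : Type*} [Fintype m] [DecidableEq m]
    (A : Matrix m m ℝ) : ℕ :=
  A.charpoly.roots.countP fun x => x < 0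

/-- The number of positive eigenvalues, with multiplicity (used for symmetric matrices). -/
noncomputable def numPosEigenvalues {m : Type*} [Fintype m] [DecidableEq m]
    (A : Matrix m m ℝ) : ℕ :=
  A.charpoly.roots.countP fun x => 0 < x

/-- The nullity of a square matrix. -/
noncomputable def nullity {m : Type*} [Fintype m] [DecidableEq m] (A : Matrix m m ℝ) : ℕ :=
  Module.finrank ℝ (LinearMap.ker (Matrix.toLin' A))

/-- The inertia `(n₋, n_z, n₊)` of a symmetric matrix. -/
noncomputable def inertia {m : Type*} [Fintype m] [DecidableEq m] (A : Matrix m m ℝ) :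
    ℕ × ℕ × ℕ :=
  (numNegEigenvalues A, nullity A, numPosEigenvalues A)

/-- Positive definiteness of the quadratic form `x ↦ x' A x`, for a square matrix that need not be
symmetric. For symmetric matrices this is `Matrix.PosDef`; the off-diagonal blocks of a symmetric
block matrix are not symmetric in general. -/
def IsPosDefForm {m : Type*} [Fintype m] (A : Matrix m m ℝ) : Prop :=
  ∀ x : m → ℝ, x ≠ 0 → 0 < x ⬝ᵥ (A *ᵥ x)

/-! Everything rests on two signs of the quadratic form of `A = D⁻¹ - βL`: it is positive on nonzero
block-constant vectors (dimension `s`) and nonpositive on vectors whose `i`-th block vanishes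
(dimension `ns - s`). These subspaces are complementary, and for invertible symmetric `A` the signs
fix the inertia, the signs of `A⁻¹`, and the inertia of the bordered matrix.

For `β = 0` the signs come from the tree. If `L_T` is the Laplacian of `T`, then `L_T D z = -2z`
whenever the blocks of `z` sum to zero (`laplacian_mulVec_distMatrix_mulVec`). Since `L_T` is
positive semidefinite, `D` is negative semidefinite on such `z`. Comparing with a vector having two
equal nonzero blocks makes `D` positive at every nonzero `z` with `Dz` block-constant
(`distMatrix_form_pos`); this gives invertibility of `D` and the first sign. The second sign follows
from `D_ii = 0` (`inv_distMatrix_form_nonpos`).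

Subtracting `βL` changes nothing on block constants, which `L` annihilates, and only lowers the form
elsewhere. For `β > 0` and `G` connected the second sign becomes strict, which yields definiteness
of the principal submatrices and positivity of the blocks of `A⁻¹`. -/

/-! ### Eigenvalue counts bounded below by dimensions of subspaces of known sign. -/

section Inertia

variable {m : Type*} [Fintype m] [DecidableEq m] {A : Matrix m m ℝ}

/-- Orthogonal coordinates that diagonalize the quadratic form of a symmetric matrix. -/
theorem exists_diagonalizing_coordinates (hA : A.IsHermitian) :
    ∃ c : (m → ℝ) →ₗ[ℝ] (m → ℝ), Function.Injective c ∧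
      ∀ x, x ⬝ᵥ (A *ᵥ x) = ∑ j, hA.eigenvalues j * (c x j) ^ 2 := by
  set V : Matrix m m ℝ := (hA.eigenvectorUnitary : Matrix m m ℝ) with hV
  have hVV : V * Vᵀ = 1 := by
    have := (Matrix.mem_unitaryGroup_iff).1 hA.eigenvectorUnitary.2
    simpa [Matrix.star_eq_conjTranspose, Matrix.conjTranspose_eq_transpose_of_trivial] using this
  have hspec : A = V * Matrix.diagonal hA.eigenvalues * Vᵀ := by
    have := hA.spectral_theorem
    rw [Unitary.conjStarAlgAut_apply] at this
    simpa [Matrix.star_eq_conjTranspose, Matrix.conjTranspose_eq_transpose_of_trivial,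
      Function.comp_def] using this
  refine ⟨Matrix.mulVecLin Vᵀ, ?_, fun x => ?_⟩
  · intro x y hxy
    have h := congrArg (fun z => V *ᵥ z) hxy
    simpa only [Matrix.mulVecLin_apply, Matrix.mulVec_mulVec, hVV, Matrix.one_mulVec] using h
  · conv_lhs => rw [hspec]
    rw [← Matrix.mulVec_mulVec, ← Matrix.mulVec_mulVec, Matrix.dotProduct_mulVec,
      ← Matrix.mulVec_transpose]
    simp only [dotProduct, Matrix.mulVec_diagonal, Matrix.mulVecLin_apply]
    exact Finset.sum_congr rfl fun j _ => by ring

theorem numPosEigenvalues_eq_card (hA : A.IsHermitian) :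
    numPosEigenvalues A = Fintype.card {j // 0 < hA.eigenvalues j} := by
  rw [numPosEigenvalues, hA.roots_charpoly_eq_eigenvalues, Multiset.countP_map,
    Fintype.card_subtype]
  rfl

theorem numNegEigenvalues_eq_card (hA : A.IsHermitian) :
    numNegEigenvalues A = Fintype.card {j // hA.eigenvalues j < 0} := by
  rw [numNegEigenvalues, hA.roots_charpoly_eq_eigenvalues, Multiset.countP_map,
    Fintype.card_subtype]
  rfl

theorem numNegEigenvalues_add_numPosEigenvalues_le (hA : A.IsHermitian) :
    numNegEigenvalues A + numPosEigenvalues A ≤ Fintype.card m := by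
  rw [numNegEigenvalues_eq_card hA, numPosEigenvalues_eq_card hA, Fintype.card_subtype,
    Fintype.card_subtype, ← Finset.card_union_of_disjoint]
  · exact Finset.card_le_univ _
  · rw [Finset.disjoint_filter]
    exact fun j _ h => h.le.not_gt

theorem nullity_eq_zero (hA : IsUnit A) : nullity A = 0 := by
  rw [nullity, Submodule.finrank_eq_zero, LinearMap.ker_eq_bot]
  exact Matrix.mulVec_injective_of_isUnit hA

theorem eigenvalues_ne_zero_of_isUnit (hA : A.IsHermitian) (hu : IsUnit A) (j : m) :
    hA.eigenvalues j ≠ 0 := by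
  intro h
  have hdet := (Matrix.isUnit_iff_isUnit_det A).1 hu
  rw [hA.det_eq_prod_eigenvalues, isUnit_iff_ne_zero] at hdet
  exact hdet (Finset.prod_eq_zero (Finset.mem_univ j) (by simp [h]))

variable {V : Type*} [AddCommGroup V] [Module ℝ V]

/-- If all coordinates of `f x` along positive eigenvalues vanish, the form at `f x` is nonpositive,
so `x = 0`; hence `V` embeds in the space of those coordinates. -/
theorem finrank_le_numPosEigenvalues (hA : A.IsHermitian) (f : V →ₗ[ℝ] (m → ℝ))
    (hf : ∀ x ≠ 0, 0 < f x ⬝ᵥ (A *ᵥ f x)) :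
    Module.finrank ℝ V ≤ numPosEigenvalues A := by
  obtain ⟨c, -, hq⟩ := exists_diagonalizing_coordinates hA
  have hinj : Function.Injective
      ((LinearMap.funLeft ℝ ℝ (Subtype.val : {j // 0 < hA.eigenvalues j} → m)) ∘ₗ c ∘ₗ f) := by
    refine (injective_iff_map_eq_zero _).2 fun x hx => ?_
    by_contra hne
    have h := hf x hne
    rw [hq] at h
    refine h.not_ge (Finset.sum_nonpos fun j _ => ?_)
    by_cases hj : 0 < hA.eigenvalues j
    · have : c (f x) j = 0 := congrFun hx ⟨j, hj⟩
      simp [this]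
    · exact mul_nonpos_of_nonpos_of_nonneg (not_lt.1 hj) (sq_nonneg _)
  simpa [numPosEigenvalues_eq_card hA] using LinearMap.finrank_le_finrank_of_injective hinj

/-- A weak sign suffices because no eigenvalue is zero: once the negative coordinates vanish, the
form is a sum of nonnegative terms that is at most zero, so the positive coordinates vanish too. -/
theorem finrank_le_numNegEigenvalues (hA : A.IsHermitian) (hu : IsUnit A)
    (f : V →ₗ[ℝ] (m → ℝ)) (hinj : Function.Injective f)
    (hf : ∀ x, f x ⬝ᵥ (A *ᵥ f x) ≤ 0) :
    Module.finrank ℝ V ≤ numNegEigenvalues A := by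
  obtain ⟨c, hc, hq⟩ := exists_diagonalizing_coordinates hA
  have hinj : Function.Injective
      ((LinearMap.funLeft ℝ ℝ (Subtype.val : {j // hA.eigenvalues j < 0} → m)) ∘ₗ c ∘ₗ f) := by
    refine (injective_iff_map_eq_zero _).2 fun x hx => ?_
    have hneg : ∀ j, hA.eigenvalues j < 0 → c (f x) j = 0 := fun j hj => congrFun hx ⟨j, hj⟩
    have hnn : ∀ j ∈ Finset.univ, 0 ≤ hA.eigenvalues j * (c (f x) j) ^ 2 := fun j _ => by
      by_cases hj : hA.eigenvalues j < 0
      · simp [hneg j hj]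
      · exact mul_nonneg (not_lt.1 hj) (sq_nonneg _)
    have h0 := le_antisymm (hq (f x) ▸ hf x) (Finset.sum_nonneg hnn)
    rw [Finset.sum_eq_zero_iff_of_nonneg hnn] at h0
    have hcx : c (f x) = 0 := funext fun j => by
      simpa [eigenvalues_ne_zero_of_isUnit hA hu j] using h0 j (Finset.mem_univ j)
    exact hinj (by rw [map_zero]; exact hc (by rw [hcx, map_zero]))
  simpa [numNegEigenvalues_eq_card hA] using LinearMap.finrank_le_finrank_of_injective hinj

end Inertia

/-! ### Calculus of block vectors. -/

section BlockVectors

variable {n s : ℕ}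

/-- The `i`-th block of a block vector. -/
def blockOf (x : Fin n × Fin s → ℝ) (i : Fin n) : Fin s → ℝ := fun a => x (i, a)

/-- The block vector all of whose blocks are `y`. -/
def constBlocks (n : ℕ) {s : ℕ} (y : Fin s → ℝ) : Fin n × Fin s → ℝ := fun p => y p.2

/-- The block vector whose `i`-th block is `y`, all other blocks being zero. -/
def singleBlock {n s : ℕ} (i : Fin n) (y : Fin s → ℝ) : Fin n × Fin s → ℝ :=
  fun p => if p.1 = i then y p.2 else 0

/-- The sum of the blocks of a block vector. -/
def blockSum (x : Fin n × Fin s → ℝ) : Fin s → ℝ := ∑ i, blockOf x i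

theorem eq_of_blockOf_eq {x y : Fin n × Fin s → ℝ} (h : ∀ i, blockOf x i = blockOf y i) :
    x = y := funext fun p => congrFun (h p.1) p.2

@[simp] theorem blockOf_constBlocks (y : Fin s → ℝ) (i : Fin n) :
    blockOf (constBlocks n y) i = y := rfl

@[simp] theorem blockOf_add (x y : Fin n × Fin s → ℝ) (i : Fin n) :
    blockOf (x + y) i = blockOf x i + blockOf y i := rfl

@[simp] theorem blockOf_sub (x y : Fin n × Fin s → ℝ) (i : Fin n) :
    blockOf (x - y) i = blockOf x i - blockOf y i := rfl

@[simp] theorem blockOf_smul (c : ℝ) (x : Fin n × Fin s → ℝ) (i : Fin n) :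
    blockOf (c • x) i = c • blockOf x i := rfl

@[simp] theorem blockOf_zero (i : Fin n) : blockOf (0 : Fin n × Fin s → ℝ) i = 0 := rfl

theorem blockOf_singleBlock (i j : Fin n) (y : Fin s → ℝ) :
    blockOf (singleBlock i y) j = if j = i then y else 0 := by
  ext a
  by_cases h : j = i <;> simp [blockOf, singleBlock, h]

@[simp] theorem blockSum_singleBlock (i : Fin n) (y : Fin s → ℝ) :
    blockSum (singleBlock i y) = y := by
  simp [blockSum, blockOf_singleBlock]

@[simp] theorem blockSum_add (x y : Fin n × Fin s → ℝ) :
    blockSum (x + y) = blockSum x + blockSum y := by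
  simp [blockSum, Finset.sum_add_distrib]

@[simp] theorem blockSum_sub (x y : Fin n × Fin s → ℝ) :
    blockSum (x - y) = blockSum x - blockSum y := by
  simp [blockSum, Finset.sum_sub_distrib]

theorem dotProduct_eq_sum_blockOf (x y : Fin n × Fin s → ℝ) :
    x ⬝ᵥ y = ∑ i, blockOf x i ⬝ᵥ blockOf y i := by
  simp [dotProduct, Fintype.sum_prod_type, blockOf]

theorem blockOf_ofBlocks_mulVec (B : Fin n → Fin n → Matrix (Fin s) (Fin s) ℝ)
    (x : Fin n × Fin s → ℝ) (i : Fin n) :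
    blockOf (ofBlocks B *ᵥ x) i = ∑ j, B i j *ᵥ blockOf x j := by
  ext a
  simp [blockOf, ofBlocks, Matrix.mulVec, dotProduct, Fintype.sum_prod_type]

theorem constBlocks_dotProduct (y : Fin s → ℝ) (x : Fin n × Fin s → ℝ) :
    constBlocks n y ⬝ᵥ x = y ⬝ᵥ blockSum x := by
  simp [dotProduct_eq_sum_blockOf, blockSum, dotProduct_sum]

theorem singleBlock_dotProduct (i : Fin n) (y : Fin s → ℝ) (x : Fin n × Fin s → ℝ) :
    singleBlock i y ⬝ᵥ x = y ⬝ᵥ blockOf x i := by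
  rw [dotProduct_eq_sum_blockOf, Finset.sum_eq_single i]
  · simp [blockOf_singleBlock]
  · intro j _ hj
    simp [blockOf_singleBlock, hj]
  · simp

theorem blockOf_mulVec_singleBlock (A : Matrix (Fin n × Fin s) (Fin n × Fin s) ℝ)
    (i j : Fin n) (y : Fin s → ℝ) :
    blockOf (A *ᵥ singleBlock j y) i = blockAt A i j *ᵥ y := by
  ext a
  simp [blockOf, blockAt, singleBlock, Matrix.mulVec, dotProduct, Fintype.sum_prod_type]

theorem blockOnes_mulVec (y : Fin s → ℝ) : blockOnes n s *ᵥ y = constBlocks n y := by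
  ext p
  have : blockOnes n s p = (1 : Matrix (Fin s) (Fin s) ℝ) p.2 := rfl
  rw [Matrix.mulVec, this]
  exact congrFun (Matrix.one_mulVec y) p.2

theorem blockOnes_transpose_mulVec (x : Fin n × Fin s → ℝ) :
    (blockOnes n s)ᵀ *ᵥ x = blockSum x := by
  ext a
  simp [blockOnes, blockSum, blockOf, Matrix.mulVec, dotProduct, Fintype.sum_prod_type,
    Matrix.one_apply]

theorem blockJ_mulVec (x : Fin n × Fin s → ℝ) :
    blockJ n s *ᵥ x = constBlocks n (blockSum x) := by
  refine eq_of_blockOf_eq fun i => ?_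
  rw [blockJ, blockOf_ofBlocks_mulVec]
  simp [blockSum]

theorem Matrix.IsSymm.dotProduct_mulVec_comm {m : Type*} [Fintype m] {A : Matrix m m ℝ}
    (hA : A.IsSymm) (x y : m → ℝ) : x ⬝ᵥ (A *ᵥ y) = y ⬝ᵥ (A *ᵥ x) := by
  rw [dotProduct_mulVec, ← mulVec_transpose, hA.eq, dotProduct_comm]

end BlockVectors

/-! ### The weighted Laplacian and its quadratic form. -/

namespace WeightedGraph

variable {n s : ℕ} (G : WeightedGraph n s)

theorem invWeight_comm (i j : Fin n) : G.invWeight i j = G.invWeight j i := by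
  by_cases h : G.graph.Adj i j
  · rw [invWeight, invWeight, if_pos h, if_pos h.symm, Sym2.eq_swap]
  · rw [invWeight, invWeight, if_neg h, if_neg fun h' => h h'.symm]

@[simp] theorem invWeight_self (i : Fin n) : G.invWeight i i = 0 := by simp [invWeight]

theorem weight_posDef_of_adj {i j : Fin n} (h : G.graph.Adj i j) :
    (G.weight s(i, j)).PosDef := G.weight_posDef _ h

theorem invWeight_posDef {i j : Fin n} (h : G.graph.Adj i j) : (G.invWeight i j).PosDef := by
  rw [invWeight, if_pos h]
  exact (G.weight_posDef_of_adj h).inv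

theorem invWeight_posSemidef (i j : Fin n) : (G.invWeight i j).PosSemidef := by
  by_cases h : G.graph.Adj i j
  · exact (G.invWeight_posDef h).posSemidef
  · rw [invWeight, if_neg h]
    exact Matrix.PosSemidef.zero

theorem invWeight_form_nonneg (i j : Fin n) (v : Fin s → ℝ) :
    0 ≤ v ⬝ᵥ (G.invWeight i j *ᵥ v) := by
  simpa using (G.invWeight_posSemidef i j).dotProduct_mulVec_nonneg v

theorem invWeight_transpose (i j : Fin n) : (G.invWeight i j)ᵀ = G.invWeight i j := by
  simpa [Matrix.conjTranspose_eq_transpose_of_trivial] using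
    (G.invWeight_posSemidef i j).isHermitian.eq

theorem laplacian_isSymm : G.laplacian.IsSymm := by
  ext ⟨i, a⟩ ⟨j, b⟩
  by_cases h : i = j
  · subst h
    simp only [Matrix.transpose_apply, laplacian, ofBlocks, Matrix.of_apply, if_true,
      Matrix.sum_apply]
    exact Finset.sum_congr rfl fun k _ => congrFun (congrFun (G.invWeight_transpose i k) a) b
  · have := congrFun (congrFun (G.invWeight_transpose i j) a) b
    simp only [Matrix.transpose_apply] at this
    simp [laplacian, ofBlocks, h, Ne.symm h, G.invWeight_comm j i, this]

theorem blockOf_laplacian_mulVec (x : Fin n × Fin s → ℝ) (i : Fin n) :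
    blockOf (G.laplacian *ᵥ x) i = ∑ k, G.invWeight i k *ᵥ (blockOf x i - blockOf x k) := by
  have h : ∀ j, (if i = j then ∑ k, G.invWeight i k else -G.invWeight i j) =
      (if i = j then ∑ k, G.invWeight i k else 0) - G.invWeight i j := fun j => by
    by_cases h : i = j
    · subst h; simp
    · simp [h]
  rw [laplacian, blockOf_ofBlocks_mulVec]
  simp only [h, Matrix.sub_mulVec, Matrix.mulVec_sub, Finset.sum_sub_distrib]
  congr 1
  rw [Finset.sum_eq_single i]
  · simp [Matrix.sum_mulVec]
  · intro j _ hj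
    simp [Ne.symm hj]
  · simp

theorem laplacian_mulVec_constBlocks (y : Fin s → ℝ) :
    G.laplacian *ᵥ constBlocks n y = 0 :=
  eq_of_blockOf_eq fun i => by simp [blockOf_laplacian_mulVec]

theorem dotProduct_laplacian_mulVec (x : Fin n × Fin s → ℝ) :
    2 * (x ⬝ᵥ (G.laplacian *ᵥ x)) = ∑ i, ∑ k,
      (blockOf x i - blockOf x k) ⬝ᵥ (G.invWeight i k *ᵥ (blockOf x i - blockOf x k)) := by
  have h1 : x ⬝ᵥ (G.laplacian *ᵥ x) =
      ∑ i, ∑ k, blockOf x i ⬝ᵥ (G.invWeight i k *ᵥ (blockOf x i - blockOf x k)) := by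
    rw [dotProduct_eq_sum_blockOf]
    simp only [blockOf_laplacian_mulVec, dotProduct_sum]
  -- Exchanging the two endpoints of each edge and adding to `h1` symmetrizes the form.
  have h2 : x ⬝ᵥ (G.laplacian *ᵥ x) =
      ∑ i, ∑ k, blockOf x k ⬝ᵥ (G.invWeight i k *ᵥ (blockOf x k - blockOf x i)) := by
    rw [h1, Finset.sum_comm]
    simp only [G.invWeight_comm]
  rw [two_mul]
  nth_rw 1 [h1]
  rw [h2, ← Finset.sum_add_distrib]
  refine Finset.sum_congr rfl fun i _ => ?_
  rw [← Finset.sum_add_distrib]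
  refine Finset.sum_congr rfl fun k _ => ?_
  rw [← neg_sub (blockOf x i) (blockOf x k), Matrix.mulVec_neg, dotProduct_neg, sub_dotProduct,
    ← sub_eq_add_neg]

theorem laplacian_form_nonneg (x : Fin n × Fin s → ℝ) : 0 ≤ x ⬝ᵥ (G.laplacian *ᵥ x) := by
  have : 0 ≤ 2 * (x ⬝ᵥ (G.laplacian *ᵥ x)) := by
    rw [dotProduct_laplacian_mulVec]
    exact Finset.sum_nonneg fun i _ => Finset.sum_nonneg fun k _ =>
      G.invWeight_form_nonneg i k _
  linarith

/-- On a connected graph the Laplacian form vanishes at block-constant vectors only. -/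
theorem blockOf_eq_of_laplacian_form_eq_zero (hG : G.graph.Connected) {x : Fin n × Fin s → ℝ}
    (hx : x ⬝ᵥ (G.laplacian *ᵥ x) = 0) (i j : Fin n) : blockOf x i = blockOf x j := by
  have hnn : ∀ i k, 0 ≤
      (blockOf x i - blockOf x k) ⬝ᵥ (G.invWeight i k *ᵥ (blockOf x i - blockOf x k)) :=
    fun i k => G.invWeight_form_nonneg i k _
  have h := G.dotProduct_laplacian_mulVec x
  rw [hx, mul_zero, eq_comm, Finset.sum_eq_zero_iff_of_nonneg
    fun i _ => Finset.sum_nonneg fun k _ => hnn i k] at h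
  have hadj : ∀ i k, G.graph.Adj i k → blockOf x i = blockOf x k := fun i k hik => by
    have h' := (Finset.sum_eq_zero_iff_of_nonneg fun k _ => hnn i k).1
      (h i (Finset.mem_univ i)) k (Finset.mem_univ k)
    by_contra hne
    have := (G.invWeight_posDef hik).dotProduct_mulVec_pos (sub_ne_zero.2 hne)
    simp [h'] at this
  obtain ⟨p⟩ := hG.preconnected i j
  induction p with
  | nil => rfl
  | cons hik _ ih => exact (hadj _ _ hik).trans ih

/-! ### Tree distances and their interaction with the Laplacian of the tree. -/

section Tree

variable {T : WeightedGraph n s} (hT : T.graph.IsTree)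


theorem treeDist_self (i : Fin n) : T.treeDist hT i i = 0 := by simp [treeDist]

theorem exists_isPath_treeDist (i j : Fin n) :
    ∃ p : T.graph.Walk i j, p.IsPath ∧ T.treeDist hT i j = T.walkWeight p := by
  obtain ⟨p, hp, -⟩ := hT.existsUnique_path i j
  exact ⟨p, hp, T.treeDist_eq_walkWeight hT p hp⟩

theorem walkWeight_cons {i j k : Fin n} (h : T.graph.Adj i j) (p : T.graph.Walk j k) :
    T.walkWeight (.cons h p) = T.weight s(i, j) + T.walkWeight p := by
  simp [walkWeight]

theorem walkWeight_posSemidef {i j : Fin n} (p : T.graph.Walk i j) :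
    (T.walkWeight p).PosSemidef := by
  induction p with
  | nil => simpa [walkWeight] using Matrix.PosSemidef.zero
  | cons h p ih =>
    rw [walkWeight_cons]
    exact (T.weight_posDef_of_adj h).posSemidef.add ih

theorem treeDist_posDef {i j : Fin n} (hij : i ≠ j) : (T.treeDist hT i j).PosDef := by
  obtain ⟨p, -, hp⟩ := exists_isPath_treeDist hT i j
  rw [hp]
  cases p with
  | nil => exact absurd rfl hij
  | cons h p =>
    rw [walkWeight_cons]
    exact (T.weight_posDef_of_adj h).add_posSemidef (walkWeight_posSemidef p)

theorem treeDist_comm (i j : Fin n) : T.treeDist hT i j = T.treeDist hT j i := by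
  obtain ⟨p, hp, h⟩ := exists_isPath_treeDist hT i j
  rw [h, T.treeDist_eq_walkWeight hT p.reverse hp.reverse]
  simp [walkWeight, List.sum_reverse]

theorem treeDist_transpose (i j : Fin n) : (T.treeDist hT i j)ᵀ = T.treeDist hT i j := by
  obtain ⟨p, -, hp⟩ := exists_isPath_treeDist hT i j
  rw [hp]
  simpa [Matrix.conjTranspose_eq_transpose_of_trivial] using
    (walkWeight_posSemidef p).isHermitian.eq

theorem distMatrix_isSymm : (T.distMatrix hT).IsSymm := by
  ext ⟨i, a⟩ ⟨j, b⟩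
  have := congrFun (congrFun (treeDist_transpose hT i j) a) b
  simpa [distMatrix, ofBlocks, treeDist_comm hT j i] using this

/-- The first step from `i` towards `j` shortens the distance to `j` by the weight of its edge;
every other step from `i` lengthens it by the weight of its edge. -/
theorem exists_step_towards {i j : Fin n} (hij : i ≠ j) :
    ∃ k, T.graph.Adj i k ∧ T.treeDist hT i j = T.weight s(i, k) + T.treeDist hT k j ∧
      ∀ l, T.graph.Adj i l → l ≠ k →
        T.treeDist hT l j = T.weight s(i, l) + T.treeDist hT i j := by
  obtain ⟨p, hp, hD⟩ := exists_isPath_treeDist hT i j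
  cases p with
  | nil => exact absurd rfl hij
  | @cons _ k _ h q =>
    have hq := (SimpleGraph.Walk.cons_isPath_iff h q).1 hp
    refine ⟨k, h, ?_, fun l hl hlk => ?_⟩
    · rw [hD, walkWeight_cons, T.treeDist_eq_walkWeight hT q hq.1]
    -- If `l` lay on the path, its initial part through `k` and the edge from `i` to `l` would be
    -- two paths from `i` to `l` with different second vertices.
    · have hnot : l ∉ (SimpleGraph.Walk.cons h q).support := by
        intro hmem
        have h1 : ((SimpleGraph.Walk.cons h q).takeUntil l hmem).IsPath := hp.takeUntil hmem
        have h2 : (SimpleGraph.Walk.cons hl SimpleGraph.Walk.nil).IsPath := by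
          simp [SimpleGraph.Walk.cons_isPath_iff, hl.ne]
        have h3 := (hT.existsUnique_path i l).unique h1 h2
        have hlq : l ∈ q.support := by
          rcases SimpleGraph.Walk.mem_support_iff _ |>.1 hmem with h | h
          · exact absurd h hl.ne'
          · simpa using h
        have h4 : (SimpleGraph.Walk.cons h (q.takeUntil l hlq)).IsPath := by
          refine (SimpleGraph.Walk.cons_isPath_iff _ _).2 ⟨hq.1.takeUntil hlq, fun hi => ?_⟩
          exact hq.2 (SimpleGraph.Walk.support_takeUntil_subset_support _ hlq hi)
        have h5 := congrArg SimpleGraph.Walk.snd ((hT.existsUnique_path i l).unique h4 h2)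
        exact hlk (by simpa using h5.symm)
      have hl' : (SimpleGraph.Walk.cons hl.symm (SimpleGraph.Walk.cons h q)).IsPath :=
        (SimpleGraph.Walk.cons_isPath_iff _ _).2 ⟨hp, hnot⟩
      rw [T.treeDist_eq_walkWeight hT _ hl', walkWeight_cons, hD, Sym2.eq_swap]

-- Each neighbour of `i` contributes `-I`, except the one towards `j`, which contributes `+I`; there
-- is no such exception when `i = j`. The part `2 - deg i` is independent of `j`, so it disappears
-- when paired with blocks summing to zero.
open Classical in
theorem sum_invWeight_mul_treeDist_sub (i j : Fin n) :
    ∑ k, T.invWeight i k * (T.treeDist hT i j - T.treeDist hT k j) =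
      (2 - (T.graph.degree i : ℝ)) • (1 : Matrix (Fin s) (Fin s) ℝ) -
        (if i = j then (2 : ℝ) else 0) • 1 := by
  have hdeg : ∑ k, (if T.graph.Adj i k then (1 : Matrix (Fin s) (Fin s) ℝ) else 0) =
      (T.graph.degree i : ℝ) • 1 := by
    rw [← Finset.sum_filter, Finset.sum_const, ← SimpleGraph.neighborFinset_eq_filter,
      SimpleGraph.card_neighborFinset_eq_degree, Nat.cast_smul_eq_nsmul]
  have hcancel : ∀ k, T.graph.Adj i k → (T.weight s(i, k))⁻¹ * T.weight s(i, k) = 1 :=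
    fun k hk => Matrix.nonsing_inv_mul _
      ((Matrix.isUnit_iff_isUnit_det _).1 (T.weight_posDef_of_adj hk).isUnit)
  by_cases hij : i = j
  · subst hij
    have hterm : ∀ k, T.invWeight i k * (T.treeDist hT i i - T.treeDist hT k i) =
        -(if T.graph.Adj i k then 1 else 0) := fun k => by
      by_cases hk : T.graph.Adj i k
      · have hp : (SimpleGraph.Walk.cons hk.symm SimpleGraph.Walk.nil).IsPath := by
          simp [SimpleGraph.Walk.cons_isPath_iff, hk.ne']
        rw [treeDist_self, T.treeDist_eq_walkWeight hT _ hp, walkWeight_cons, Sym2.eq_swap]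
        simp [invWeight, hk, walkWeight, hcancel k hk]
      · simp [invWeight, hk]
    rw [Finset.sum_congr rfl fun k _ => hterm k, Finset.sum_neg_distrib, hdeg, if_pos rfl,
      ← sub_smul, ← neg_smul]
    congr 1
    ring
  · obtain ⟨k₀, hk₀, hstep, hother⟩ := exists_step_towards hT hij
    -- The `+I` of the neighbour `k₀` is written as `2I - I`, so that the `-I` terms add up to the
    -- degree.
    have hterm : ∀ k, T.invWeight i k * (T.treeDist hT i j - T.treeDist hT k j) =
        (if k = k₀ then (2 : ℝ) • (1 : Matrix (Fin s) (Fin s) ℝ) else 0) -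
          (if T.graph.Adj i k then 1 else 0) := fun k => by
      by_cases hk : T.graph.Adj i k
      · by_cases hkk : k = k₀
        · subst hkk
          rw [hstep, add_sub_cancel_right, invWeight, if_pos hk, if_pos hk, if_pos rfl,
            hcancel k hk, two_smul, add_sub_cancel_right]
        · rw [hother k hk hkk, invWeight, if_pos hk, if_pos hk, if_neg hkk,
            sub_add_cancel_right, mul_neg, hcancel k hk, zero_sub]
      · have : k ≠ k₀ := fun h => hk (h ▸ hk₀)
        simp [invWeight, hk, this]
    rw [Finset.sum_congr rfl fun k _ => hterm k, Finset.sum_sub_distrib, hdeg, if_neg hij,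
      Finset.sum_ite_eq' Finset.univ k₀]
    simp [sub_smul]

theorem laplacian_mulVec_distMatrix_mulVec {z : Fin n × Fin s → ℝ} (hz : blockSum z = 0) :
    T.laplacian *ᵥ (T.distMatrix hT *ᵥ z) = (-2 : ℝ) • z := by
  classical
  refine eq_of_blockOf_eq fun i => ?_
  rw [blockOf_laplacian_mulVec]
  have h : ∀ k, T.invWeight i k *ᵥ
      (blockOf (T.distMatrix hT *ᵥ z) i - blockOf (T.distMatrix hT *ᵥ z) k) =
      ∑ j, (T.invWeight i k * (T.treeDist hT i j - T.treeDist hT k j)) *ᵥ blockOf z j :=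
    fun k => by
      simp only [distMatrix, blockOf_ofBlocks_mulVec]
      rw [← Finset.sum_sub_distrib, Matrix.mulVec_sum]
      simp only [← Matrix.sub_mulVec, Matrix.mulVec_mulVec]
  rw [Finset.sum_congr rfl fun k _ => h k, Finset.sum_comm]
  simp only [← Matrix.sum_mulVec, sum_invWeight_mul_treeDist_sub, Matrix.sub_mulVec,
    Matrix.smul_mulVec, Matrix.one_mulVec, Finset.sum_sub_distrib, ← Finset.smul_sum]
  rw [show ∑ j, blockOf z j = 0 from hz, blockOf_smul]
  simp

end Tree

end WeightedGraph

/-! ### Principal block submatrices and forms of block matrices. -/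

section BlockForms

variable {n s : ℕ} {A : Matrix (Fin n × Fin s) (Fin n × Fin s) ℝ}

theorem Matrix.IsSymm.isHermitian_real {m : Type*} {A : Matrix m m ℝ} (hA : A.IsSymm) :
    A.IsHermitian := by
  rw [IsHermitian, conjTranspose_eq_transpose_of_trivial, hA.eq]

/-- The inclusion of the index set of a principal block submatrix. -/
def blockInclusion {n : ℕ} (s : ℕ) (Δ : Finset (Fin n)) : Δ × Fin s → Fin n × Fin s :=
  fun p => (p.1, p.2)

theorem blockInclusion_injective (Δ : Finset (Fin n)) :
    Function.Injective (blockInclusion s Δ) := by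
  intro p q h
  obtain ⟨h₁, h₂⟩ := Prod.mk.inj h
  exact Prod.ext (Subtype.ext h₁) h₂

/-- Extension by zero of the block vectors with blocks in `Δ`. -/
noncomputable def extendBlocks {n : ℕ} (s : ℕ) (Δ : Finset (Fin n)) :
    (Δ × Fin s → ℝ) →ₗ[ℝ] (Fin n × Fin s → ℝ) :=
  Function.ExtendByZero.linearMap ℝ (blockInclusion s Δ)

theorem extendBlocks_apply (Δ : Finset (Fin n)) (w : Δ × Fin s → ℝ) (p : Δ × Fin s) :
    extendBlocks s Δ w (blockInclusion s Δ p) = w p :=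
  (blockInclusion_injective Δ).extend_apply w 0 p

theorem extendBlocks_injective (Δ : Finset (Fin n)) :
    Function.Injective (extendBlocks s Δ) := fun w w' h => funext fun p => by
  rw [← extendBlocks_apply Δ w, h, extendBlocks_apply]

theorem blockOf_extendBlocks {Δ : Finset (Fin n)} {i : Fin n} (hi : i ∉ Δ)
    (w : Δ × Fin s → ℝ) : blockOf (extendBlocks s Δ w) i = 0 := by
  ext a
  refine Function.extend_apply' w (0 : Fin n × Fin s → ℝ) _ ?_
  rintro ⟨p, hp⟩
  have h : (p.1 : Fin n) = i := congrArg Prod.fst hp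
  exact hi (h ▸ p.1.2)

theorem extendBlocks_dotProduct (Δ : Finset (Fin n)) (w : Δ × Fin s → ℝ)
    (f : Fin n × Fin s → ℝ) :
    extendBlocks s Δ w ⬝ᵥ f = w ⬝ᵥ fun p => f (blockInclusion s Δ p) := by
  refine (Fintype.sum_of_injective _ (blockInclusion_injective Δ) _ _ (fun p hp => ?_)
    fun p => ?_).symm
  · have : extendBlocks s Δ w p = 0 := Function.extend_apply' w (0 : Fin n × Fin s → ℝ) _ hp
    rw [this, zero_mul]
  · rw [extendBlocks_apply]

theorem principalBlocks_form (Δ : Finset (Fin n)) (w : Δ × Fin s → ℝ) :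
    w ⬝ᵥ (principalBlocks A Δ *ᵥ w) = extendBlocks s Δ w ⬝ᵥ (A *ᵥ extendBlocks s Δ w) := by
  rw [extendBlocks_dotProduct]
  congr 1
  ext p
  rw [Matrix.mulVec, Matrix.mulVec, dotProduct_comm, dotProduct_comm (A _),
    extendBlocks_dotProduct]
  rfl

theorem principalBlocks_isSymm (hA : A.IsSymm) (Δ : Finset (Fin n)) :
    (principalBlocks A Δ).IsSymm :=
  hA.submatrix (blockInclusion s Δ)

theorem finrank_extendBlocks_domain (i : Fin n) :
    Module.finrank ℝ (↥(Finset.univ \ {i}) × Fin s → ℝ) = n * s - s := by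
  simp [Nat.sub_mul]

theorem constBlocks_add (y y' : Fin s → ℝ) :
    constBlocks n (y + y') = constBlocks n y + constBlocks n y' := rfl

theorem constBlocks_smul (c : ℝ) (y : Fin s → ℝ) :
    constBlocks n (c • y) = c • constBlocks n y := rfl

/-- `constBlocks` as a linear map. -/
def constBlocksₗ (n s : ℕ) : (Fin s → ℝ) →ₗ[ℝ] (Fin n × Fin s → ℝ) where
  toFun := constBlocks n
  map_add' := constBlocks_add
  map_smul' := constBlocks_smul

theorem form_constBlocks_add (hA : A.IsSymm) (y : Fin s → ℝ) (w : Fin n × Fin s → ℝ) :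
    (w + constBlocks n y) ⬝ᵥ (A *ᵥ (w + constBlocks n y)) =
      w ⬝ᵥ (A *ᵥ w) + 2 * (w ⬝ᵥ (A *ᵥ constBlocks n y)) +
        constBlocks n y ⬝ᵥ (A *ᵥ constBlocks n y) := by
  rw [Matrix.mulVec_add, add_dotProduct, dotProduct_add, dotProduct_add,
    hA.dotProduct_mulVec_comm (constBlocks n y) w]
  ring

theorem isUnit_of_mulVec_eq_zero {m : Type*} [Fintype m] [DecidableEq m] {B : Matrix m m ℝ}
    (h : ∀ v, B *ᵥ v = 0 → v = 0) : IsUnit B :=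
  Matrix.mulVec_injective_iff_isUnit.1
    ((injective_iff_map_eq_zero (Matrix.mulVecLin B)).2 h)

theorem mulVec_inv_mulVec {m : Type*} [Fintype m] [DecidableEq m] {B : Matrix m m ℝ}
    (h : IsUnit B) (x : m → ℝ) : B *ᵥ (B⁻¹ *ᵥ x) = x := by
  rw [Matrix.mulVec_mulVec, Matrix.mul_nonsing_inv _ ((Matrix.isUnit_iff_isUnit_det _).1 h),
    Matrix.one_mulVec]

theorem inv_mulVec_mulVec {m : Type*} [Fintype m] [DecidableEq m] {B : Matrix m m ℝ}
    (h : IsUnit B) (x : m → ℝ) : B⁻¹ *ᵥ (B *ᵥ x) = x := by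
  rw [Matrix.mulVec_mulVec, Matrix.nonsing_inv_mul _ ((Matrix.isUnit_iff_isUnit_det _).1 h),
    Matrix.one_mulVec]

theorem Matrix.IsSymm.inv_real {m : Type*} [Fintype m] [DecidableEq m] {B : Matrix m m ℝ}
    (h : B.IsSymm) : B⁻¹.IsSymm := by
  rw [Matrix.IsSymm, Matrix.transpose_nonsing_inv, h.eq]

/-! ### Consequences of the two sign conditions for inertia and inverse. -/

variable (hA : A.IsSymm)
  (hpos : ∀ y ≠ 0, 0 < constBlocks n y ⬝ᵥ (A *ᵥ constBlocks n y))
  (hneg : ∀ i w, blockOf w i = 0 → w ⬝ᵥ (A *ᵥ w) ≤ 0)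

include hpos in
theorem constBlocks_form_nonneg (y : Fin s → ℝ) :
    0 ≤ constBlocks n y ⬝ᵥ (A *ᵥ constBlocks n y) := by
  by_cases hy : y = 0
  · have : constBlocks n y = 0 := by subst hy; rfl
    simp [this]
  · exact (hpos y hy).le

-- The two subspaces have dimensions adding up to `ns`, so both lower bounds on the eigenvalue
-- counts are attained.
include hA hpos hneg in
theorem inertia_eq (hu : IsUnit A) (i : Fin n) : inertia A = (n * s - s, 0, s) := by
  have h1 := finrank_le_numPosEigenvalues hA.isHermitian_real (constBlocksₗ n s) hpos
  have h2 := finrank_le_numNegEigenvalues hA.isHermitian_real hu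
    (extendBlocks s (Finset.univ \ {i})) (extendBlocks_injective _)
    fun w => hneg i _ (blockOf_extendBlocks (by simp) w)
  have h3 := numNegEigenvalues_add_numPosEigenvalues_le hA.isHermitian_real
  rw [finrank_extendBlocks_domain] at h2
  simp only [Module.finrank_fintype_fun_eq_card, Fintype.card_prod, Fintype.card_fin] at h1 h3
  rw [inertia, nullity_eq_zero hu, Prod.mk.injEq, Prod.mk.injEq]
  refine ⟨?_, rfl, ?_⟩ <;> omega

-- Write `v = A⁻¹x = w + c` with `c` block-constant and `w` zero in block `i`. Zero block sum makes
-- `c` orthogonal to `Av = x`, so `v'Av = w'Aw - c'Ac`.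
include hA hpos hneg in
theorem inv_form_nonpos (hu : IsUnit A) (i : Fin n) {x : Fin n × Fin s → ℝ}
    (hx : blockSum x = 0) : x ⬝ᵥ (A⁻¹ *ᵥ x) ≤ 0 := by
  set v := A⁻¹ *ᵥ x with hv
  have hAv : A *ᵥ v = x := mulVec_inv_mulVec hu x
  set y := blockOf v i
  obtain ⟨w, hw⟩ : ∃ w, v = w + constBlocks n y := ⟨v - constBlocks n y, by simp⟩
  have hwi : blockOf w i = 0 := by
    have : blockOf v i = blockOf w i + y := by rw [hw, blockOf_add, blockOf_constBlocks]
    simpa [y] using this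
  have h1 : constBlocks n y ⬝ᵥ (A *ᵥ w) + constBlocks n y ⬝ᵥ (A *ᵥ constBlocks n y) = 0 := by
    rw [← dotProduct_add, ← Matrix.mulVec_add, ← hw, hAv, constBlocks_dotProduct, hx,
      dotProduct_zero]
  rw [← hAv, dotProduct_comm, hw, form_constBlocks_add hA,
    hA.dotProduct_mulVec_comm w (constBlocks n y)]
  have h2 := constBlocks_form_nonneg hpos y
  have h3 := hneg i w hwi
  linarith

-- With the same splitting `v = w + c`, now `w` is orthogonal to `Av`, which lives in block `i`;
-- hence `v'Av = c'Ac - w'Aw`.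
include hA hpos in
theorem inv_diagonal_block_form_pos (hu : IsUnit A)
    (hneg' : ∀ i w, blockOf w i = 0 → w ≠ 0 → w ⬝ᵥ (A *ᵥ w) < 0) (i : Fin n)
    {x : Fin s → ℝ} (hx : x ≠ 0) : 0 < x ⬝ᵥ (blockAt A⁻¹ i i *ᵥ x) := by
  rw [← blockOf_mulVec_singleBlock]
  set v := A⁻¹ *ᵥ singleBlock i x with hv
  have hAv : A *ᵥ v = singleBlock i x := mulVec_inv_mulVec hu _
  set y := blockOf v i with hy
  obtain ⟨w, hw⟩ : ∃ w, v = w + constBlocks n y := ⟨v - constBlocks n y, by simp⟩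
  have hwi : blockOf w i = 0 := by
    have : blockOf v i = blockOf w i + y := by rw [hw, blockOf_add, blockOf_constBlocks]
    simpa [y] using this
  have h1 : w ⬝ᵥ (A *ᵥ w) + w ⬝ᵥ (A *ᵥ constBlocks n y) = 0 := by
    rw [← dotProduct_add, ← Matrix.mulVec_add, ← hw, hAv, dotProduct_comm,
      singleBlock_dotProduct, hwi, dotProduct_zero]
  have h2 : x ⬝ᵥ y = v ⬝ᵥ (A *ᵥ v) := by
    rw [hAv, dotProduct_comm v, singleBlock_dotProduct]
  rw [h2, hw, form_constBlocks_add hA]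
  -- Strictness comes from `c` when `w = 0`, and from `w` otherwise.
  by_cases hw0 : w = 0
  · subst hw0
    have hy0 : y ≠ 0 := by
      intro hy0
      have hv0 : v = 0 := by rw [hw, hy0]; ext p; simp [constBlocks]
      have := congrArg blockSum hAv
      rw [hv0, Matrix.mulVec_zero, blockSum_singleBlock] at this
      exact hx (by rw [← this]; simp [blockSum])
    have := hpos y hy0
    simp only [Matrix.mulVec_zero, zero_dotProduct]
    linarith
  · have h3 := constBlocks_form_nonneg hpos y
    have h4 := hneg' i w hwi hw0
    linarith

-- The vector with blocks `x` at `i` and `-x` at `j` has zero block sum, so `inv_form_nonpos` bounds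
-- `2 x'B_ij x` below by the sum of the two diagonal forms, both positive.
include hA hpos hneg in
theorem inv_block_isPosDefForm (hu : IsUnit A)
    (hneg' : ∀ i w, blockOf w i = 0 → w ≠ 0 → w ⬝ᵥ (A *ᵥ w) < 0) (i j : Fin n) :
    IsPosDefForm (blockAt A⁻¹ i j) := by
  intro x hx
  have hi := inv_diagonal_block_form_pos hA hpos hu hneg' i hx
  have hj := inv_diagonal_block_form_pos hA hpos hu hneg' j hx
  have h := inv_form_nonpos hA hpos hneg hu i (x := singleBlock i x - singleBlock j x) (by simp)
  rw [Matrix.mulVec_sub, sub_dotProduct, dotProduct_sub, dotProduct_sub,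
    hA.inv_real.dotProduct_mulVec_comm (singleBlock j x) (singleBlock i x)] at h
  simp only [singleBlock_dotProduct, blockOf_mulVec_singleBlock] at h
  linarith

/-! ### The bordered matrix. -/

theorem fromBlocks_mulVec_elim (v : Fin n × Fin s → ℝ) (y : Fin s → ℝ) :
    Matrix.fromBlocks A⁻¹ (blockOnes n s) (blockOnes n s)ᵀ 0 *ᵥ Sum.elim v y =
      Sum.elim (A⁻¹ *ᵥ v + constBlocks n y) (blockSum v) := by
  rw [Matrix.fromBlocks_mulVec]
  simp [blockOnes_mulVec, blockOnes_transpose_mulVec]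

theorem sumElim_dotProduct {l m : Type*} [Fintype l] [Fintype m] (a c : l → ℝ) (b d : m → ℝ) :
    Sum.elim a b ⬝ᵥ Sum.elim c d = a ⬝ᵥ c + b ⬝ᵥ d := by
  simp [dotProduct]

theorem fromBlocks_form (v : Fin n × Fin s → ℝ) (y : Fin s → ℝ) :
    Sum.elim v y ⬝ᵥ (Matrix.fromBlocks A⁻¹ (blockOnes n s) (blockOnes n s)ᵀ 0 *ᵥ Sum.elim v y) =
      v ⬝ᵥ (A⁻¹ *ᵥ v) + 2 * (constBlocks n y ⬝ᵥ v) := by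
  rw [fromBlocks_mulVec_elim, sumElim_dotProduct, dotProduct_add, ← constBlocks_dotProduct,
    dotProduct_comm v (constBlocks n y)]
  ring

include hpos in
theorem isUnit_bordered (hu : IsUnit A) :
    IsUnit (Matrix.fromBlocks A⁻¹ (blockOnes n s) (blockOnes n s)ᵀ 0) := by
  refine isUnit_of_mulVec_eq_zero fun u hu0 => ?_
  obtain ⟨v, y, rfl⟩ : ∃ v y, u = Sum.elim v y :=
    ⟨_, _, (Sum.elim_comp_inl_inr u).symm⟩
  rw [fromBlocks_mulVec_elim] at hu0
  have h1 : A⁻¹ *ᵥ v + constBlocks n y = 0 := funext fun p => congrFun hu0 (Sum.inl p)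
  have h2 : blockSum v = 0 := funext fun a => congrFun hu0 (Sum.inr a)
  have h3 : v + A *ᵥ constBlocks n y = 0 := by
    have := congrArg (A *ᵥ ·) h1
    simpa [Matrix.mulVec_add, mulVec_inv_mulVec hu] using this
  have h4 : constBlocks n y ⬝ᵥ (A *ᵥ constBlocks n y) = 0 := by
    rw [eq_neg_of_add_eq_zero_right h3, dotProduct_neg, constBlocks_dotProduct, h2,
      dotProduct_zero, neg_zero]
  have hy : y = 0 := by
    by_contra hy
    exact (hpos y hy).ne' h4
  have hv : v = 0 := by
    have h0 : constBlocks n y = 0 := by subst hy; rfl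
    simpa [h0] using h3
  subst hy hv
  ext (p | a) <;> rfl

/-- `(w, y) ↦ (A (w + e ⊗ y), - y)`, which diagonalizes the bordered matrix. -/
noncomputable def borderedMap (A : Matrix (Fin n × Fin s) (Fin n × Fin s) ℝ) :
    ((Fin n × Fin s → ℝ) × (Fin s → ℝ)) →ₗ[ℝ] (Fin n × Fin s ⊕ Fin s → ℝ) where
  toFun u := Sum.elim (A *ᵥ (u.1 + constBlocks n u.2)) (-u.2)
  map_add' u u' := by
    ext (p | a)
    · simp only [Prod.fst_add, Prod.snd_add, constBlocks_add, Sum.elim_inl, Pi.add_apply,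
        Matrix.mulVec_add]
      ring
    · simp [add_comm]
  map_smul' c u := by
    ext (p | a)
    · simp [constBlocks_smul, ← smul_add, Matrix.mulVec_smul]
    · simp

theorem borderedMap_injective (hu : IsUnit A) : Function.Injective (borderedMap A) := by
  refine (injective_iff_map_eq_zero _).2 ?_
  rintro ⟨w, y⟩ h
  have h1 : A *ᵥ (w + constBlocks n y) = 0 := funext fun p => congrFun h (Sum.inl p)
  have h2 : -y = 0 := funext fun a => congrFun h (Sum.inr a)
  have hy : y = 0 := neg_eq_zero.1 h2
  have h0 : constBlocks n y = 0 := by subst hy; rfl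
  have hw : w = 0 := by
    rw [← inv_mulVec_mulVec hu w]
    rw [h0, add_zero] at h1
    rw [h1, Matrix.mulVec_zero]
  rw [hy, hw]
  rfl

-- The sign in `-y` is chosen so that the border contributes `-2c'A(w + c)`, where `c` has all
-- blocks `y`; this cancels the cross term of `(w + c)'A(w + c)`.
include hA in
theorem borderedMap_form (hu : IsUnit A) (w : Fin n × Fin s → ℝ) (y : Fin s → ℝ) :
    borderedMap A (w, y) ⬝ᵥ (Matrix.fromBlocks A⁻¹ (blockOnes n s) (blockOnes n s)ᵀ 0 *ᵥ
      borderedMap A (w, y)) =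
      w ⬝ᵥ (A *ᵥ w) - constBlocks n y ⬝ᵥ (A *ᵥ constBlocks n y) := by
  have h : constBlocks n (-y) = -constBlocks n y := rfl
  change Sum.elim _ _ ⬝ᵥ (_ *ᵥ Sum.elim _ _) = _
  rw [fromBlocks_form, inv_mulVec_mulVec hu, dotProduct_comm, form_constBlocks_add hA, h,
    neg_dotProduct, Matrix.mulVec_add, dotProduct_add,
    hA.dotProduct_mulVec_comm (constBlocks n y) w]
  ring

theorem bordered_isSymm (hA : A.IsSymm) :
    (Matrix.fromBlocks A⁻¹ (blockOnes n s) (blockOnes n s)ᵀ 0).IsSymm :=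
  hA.inv_real.fromBlocks rfl (Matrix.isSymm_zero)

-- In the coordinates of `borderedMap`, block constants `w` with `y = 0` give `s` positive
-- directions, while `w` with zero block `i` and arbitrary `y` give `ns` nonpositive ones; the order
-- is `ns + s`.
include hA hpos hneg in
theorem numPosEigenvalues_bordered (hu : IsUnit A) (i : Fin n) :
    numPosEigenvalues (Matrix.fromBlocks A⁻¹ (blockOnes n s) (blockOnes n s)ᵀ 0) = s := by
  have hB := (bordered_isSymm hA).isHermitian_real
  have h1 := finrank_le_numPosEigenvalues hB
    (borderedMap A ∘ₗ LinearMap.inl ℝ _ _ ∘ₗ constBlocksₗ n s) fun y hy => by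
      change 0 < borderedMap A (constBlocks n y, 0) ⬝ᵥ (_ *ᵥ borderedMap A (constBlocks n y, 0))
      rw [borderedMap_form hA hu, show constBlocks n (0 : Fin s → ℝ) = 0 from rfl,
        zero_dotProduct, sub_zero]
      exact hpos y hy
  have h2 := finrank_le_numNegEigenvalues hB (isUnit_bordered hpos hu)
    (borderedMap A ∘ₗ LinearMap.prodMap (extendBlocks s (Finset.univ \ {i})) LinearMap.id)
    ((borderedMap_injective hu).comp
      ((extendBlocks_injective _).prodMap Function.injective_id)) fun ⟨w, y⟩ => by
      change borderedMap A (extendBlocks s _ w, y) ⬝ᵥ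
        (_ *ᵥ borderedMap A (extendBlocks s _ w, y)) ≤ 0
      rw [borderedMap_form hA hu]
      have h3 := hneg i _ (blockOf_extendBlocks (Δ := Finset.univ \ {i}) (by simp) w)
      have h4 := constBlocks_form_nonneg hpos y
      linarith
  have h3 := numNegEigenvalues_add_numPosEigenvalues_le hB
  rw [Module.finrank_prod, finrank_extendBlocks_domain] at h2
  simp only [Module.finrank_fintype_fun_eq_card, Fintype.card_sum, Fintype.card_prod,
    Fintype.card_fin] at h1 h2 h3
  have h4 : s ≤ n * s := Nat.le_mul_of_pos_left s (Fin.pos i)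
  omega

end BlockForms

/-! ### Signs of the forms of `D`, `D⁻¹` and `D⁻¹ - βL`. -/

namespace WeightedGraph

variable {n s : ℕ} {T : WeightedGraph n s} (hT : T.graph.IsTree)

/-- The distance matrix is negative semidefinite on the block vectors with zero block sum. -/
theorem distMatrix_form_nonpos {z : Fin n × Fin s → ℝ} (hz : blockSum z = 0) :
    z ⬝ᵥ (T.distMatrix hT *ᵥ z) ≤ 0 := by
  have h := T.laplacian_form_nonneg (T.distMatrix hT *ᵥ z)
  rw [laplacian_mulVec_distMatrix_mulVec hT hz, dotProduct_smul, smul_eq_mul,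
    dotProduct_comm] at h
  linarith

theorem blockAt_distMatrix (i j : Fin n) :
    blockAt (T.distMatrix hT) i j = T.treeDist hT i j := rfl

/-- Allowing any `y` serves two purposes: `y = 0` excludes a kernel of `D`, and `y ≠ 0` gives the
sign of `D⁻¹` on block constants. -/
theorem distMatrix_form_pos (hn : 2 ≤ n) {z : Fin n × Fin s → ℝ} {y : Fin s → ℝ}
    (hz : T.distMatrix hT *ᵥ z = constBlocks n y) (hz0 : z ≠ 0) :
    0 < z ⬝ᵥ (T.distMatrix hT *ᵥ z) := by
  set x := blockSum z with hx
  have hx0 : x ≠ 0 := fun h => by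
    have h1 := laplacian_mulVec_distMatrix_mulVec hT (z := z) h
    rw [hz, laplacian_mulVec_constBlocks] at h1
    exact hz0 ((smul_eq_zero.1 h1.symm).resolve_left (by norm_num))
  obtain ⟨i, j, hij⟩ : ∃ i j : Fin n, i ≠ j :=
    ⟨⟨0, by omega⟩, ⟨1, by omega⟩, by simp⟩
  -- Both `u` and `2z` have block sum `2x`, so `w` has block sum zero and is orthogonal to the
  -- block-constant `Dz`. Hence `u'Du = 4 z'Dz + w'Dw`, where `w'Dw ≤ 0` and `u'Du = 2 x'D_ij x >
  -- 0`.
  set u := singleBlock i x + singleBlock j x with hu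
  set w := u - (2 : ℝ) • z with hw
  have hw0 : blockSum w = 0 := by
    simp [hw, hu, ← hx, two_smul]
  have huw : u = (2 : ℝ) • z + w := by rw [hw]; abel
  have hsymm := distMatrix_isSymm hT
  have h1 : u ⬝ᵥ (T.distMatrix hT *ᵥ u) = 2 * (x ⬝ᵥ (T.treeDist hT i j *ᵥ x)) := by
    rw [hu, Matrix.mulVec_add, add_dotProduct, dotProduct_add, dotProduct_add]
    simp only [singleBlock_dotProduct, blockOf_mulVec_singleBlock, blockAt_distMatrix,
      treeDist_self, Matrix.zero_mulVec, dotProduct_zero, treeDist_comm hT j i]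
    ring
  have h2 : w ⬝ᵥ (T.distMatrix hT *ᵥ z) = 0 := by
    rw [hz, dotProduct_comm, constBlocks_dotProduct, hw0, dotProduct_zero]
  have h3 : u ⬝ᵥ (T.distMatrix hT *ᵥ u) =
      4 * (z ⬝ᵥ (T.distMatrix hT *ᵥ z)) + w ⬝ᵥ (T.distMatrix hT *ᵥ w) := by
    rw [huw, Matrix.mulVec_add, add_dotProduct, dotProduct_add, dotProduct_add,
      Matrix.mulVec_smul, dotProduct_smul, smul_dotProduct, smul_dotProduct, dotProduct_smul,
      hsymm.dotProduct_mulVec_comm z w, h2]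
    simp only [smul_eq_mul]
    ring
  have h4 : 0 < x ⬝ᵥ (T.treeDist hT i j *ᵥ x) := by
    simpa using (treeDist_posDef hT hij).dotProduct_mulVec_pos hx0
  have h5 := distMatrix_form_nonpos hT hw0
  linarith

theorem isUnit_distMatrix (hn : 2 ≤ n) : IsUnit (T.distMatrix hT) := by
  refine isUnit_of_mulVec_eq_zero fun z hz => ?_
  by_contra hz0
  have h := distMatrix_form_pos hT hn (y := 0) (hz.trans rfl) hz0
  simp [hz] at h

theorem constBlocks_inv_distMatrix_form_pos (hn : 2 ≤ n) {y : Fin s → ℝ} (hy : y ≠ 0) :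
    0 < constBlocks n y ⬝ᵥ ((T.distMatrix hT)⁻¹ *ᵥ constBlocks n y) := by
  have hD := mulVec_inv_mulVec (isUnit_distMatrix hT hn) (constBlocks n y)
  have h := distMatrix_form_pos hT hn hD fun h0 => hy ?_
  · rwa [hD, dotProduct_comm] at h
  · rw [h0, Matrix.mulVec_zero] at hD
    exact (congrArg (blockOf · (⟨0, by omega⟩ : Fin n)) hD).symm

theorem inv_distMatrix_form_nonpos (hn : 2 ≤ n) (i : Fin n) {w : Fin n × Fin s → ℝ}
    (hw : blockOf w i = 0) : w ⬝ᵥ ((T.distMatrix hT)⁻¹ *ᵥ w) ≤ 0 := by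
  set z := (T.distMatrix hT)⁻¹ *ᵥ w with hz
  have hD : T.distMatrix hT *ᵥ z = w := mulVec_inv_mulVec (isUnit_distMatrix hT hn) w
  -- Moving the whole block sum of `z` into block `i` leaves `z₀` with zero sum. Both `e'Dz` (as `w`
  -- vanishes at `i`) and `e'De` (as `D_ii = 0`) are zero, so `w'D⁻¹w = z₀'Dz₀`.
  set e := singleBlock i (blockSum z) with he
  obtain ⟨z₀, hz₀⟩ : ∃ z₀, z = z₀ + e := ⟨z - e, by simp⟩
  have hsum : blockSum z₀ = 0 := by
    have : blockSum z = blockSum z₀ + blockSum z := by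
      conv_lhs => rw [hz₀, blockSum_add, he, blockSum_singleBlock]
    simpa using this
  have h1 : e ⬝ᵥ (T.distMatrix hT *ᵥ z) = 0 := by
    rw [hD, he, singleBlock_dotProduct, hw, dotProduct_zero]
  have h2 : e ⬝ᵥ (T.distMatrix hT *ᵥ e) = 0 := by
    rw [he, singleBlock_dotProduct, blockOf_mulVec_singleBlock, blockAt_distMatrix,
      treeDist_self, Matrix.zero_mulVec, dotProduct_zero]
  have h3 := distMatrix_form_nonpos hT hsum
  have hDz : T.distMatrix hT *ᵥ z = T.distMatrix hT *ᵥ z₀ + T.distMatrix hT *ᵥ e := by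
    rw [← Matrix.mulVec_add, ← hz₀]
  have h4 : w ⬝ᵥ z = z₀ ⬝ᵥ (T.distMatrix hT *ᵥ z) + e ⬝ᵥ (T.distMatrix hT *ᵥ z) := by
    rw [← add_dotProduct, ← hz₀, hD, dotProduct_comm]
  rw [h1, hDz, dotProduct_add, (distMatrix_isSymm hT).dotProduct_mulVec_comm z₀ e] at h4
  rw [hDz, dotProduct_add, h2] at h1
  linarith

variable (G : WeightedGraph n s) {β : ℝ}

theorem perturbed_isSymm : ((T.distMatrix hT)⁻¹ - β • G.laplacian).IsSymm :=
  (distMatrix_isSymm hT).inv_real.sub (G.laplacian_isSymm.smul β)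

theorem perturbed_mulVec (x : Fin n × Fin s → ℝ) :
    ((T.distMatrix hT)⁻¹ - β • G.laplacian) *ᵥ x =
      (T.distMatrix hT)⁻¹ *ᵥ x - β • (G.laplacian *ᵥ x) := by
  rw [Matrix.sub_mulVec, Matrix.smul_mulVec]

theorem perturbed_form (x : Fin n × Fin s → ℝ) :
    x ⬝ᵥ (((T.distMatrix hT)⁻¹ - β • G.laplacian) *ᵥ x) =
      x ⬝ᵥ ((T.distMatrix hT)⁻¹ *ᵥ x) - β * (x ⬝ᵥ (G.laplacian *ᵥ x)) := by
  rw [perturbed_mulVec, dotProduct_sub, dotProduct_smul, smul_eq_mul]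

theorem constBlocks_perturbed_form_pos (hn : 2 ≤ n) (y : Fin s → ℝ) (hy : y ≠ 0) :
    0 < constBlocks n y ⬝ᵥ (((T.distMatrix hT)⁻¹ - β • G.laplacian) *ᵥ constBlocks n y) := by
  rw [perturbed_form, laplacian_mulVec_constBlocks, dotProduct_zero, mul_zero, sub_zero]
  exact constBlocks_inv_distMatrix_form_pos hT hn hy

theorem perturbed_form_nonpos (hn : 2 ≤ n) (hβ : 0 ≤ β) (i : Fin n) (w : Fin n × Fin s → ℝ)
    (hw : blockOf w i = 0) :
    w ⬝ᵥ (((T.distMatrix hT)⁻¹ - β • G.laplacian) *ᵥ w) ≤ 0 := by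
  rw [perturbed_form]
  have h1 := inv_distMatrix_form_nonpos hT hn i hw
  have h2 := mul_nonneg hβ (G.laplacian_form_nonneg w)
  linarith

variable {G}

theorem perturbed_form_neg (hn : 2 ≤ n) (hG : G.graph.Connected) (hβ : 0 < β) (i : Fin n)
    (w : Fin n × Fin s → ℝ) (hw : blockOf w i = 0) (hw0 : w ≠ 0) :
    w ⬝ᵥ (((T.distMatrix hT)⁻¹ - β • G.laplacian) *ᵥ w) < 0 := by
  rw [perturbed_form]
  have h1 := inv_distMatrix_form_nonpos hT hn i hw
  have h2 : 0 < w ⬝ᵥ (G.laplacian *ᵥ w) :=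
    lt_of_le_of_ne (G.laplacian_form_nonneg w) fun h => hw0 <| eq_of_blockOf_eq fun j =>
      (G.blockOf_eq_of_laplacian_form_eq_zero hG h.symm j i).trans hw
  have h3 := mul_pos hβ h2
  linarith

theorem isUnit_perturbed (hn : 2 ≤ n) (hG : G.graph.Connected) (hβ : 0 ≤ β) :
    IsUnit ((T.distMatrix hT)⁻¹ - β • G.laplacian) := by
  obtain rfl | hβ' := hβ.eq_or_lt
  · rw [zero_smul, sub_zero, Matrix.isUnit_nonsing_inv_iff]
    exact isUnit_distMatrix hT hn
  refine isUnit_of_mulVec_eq_zero fun v hv => ?_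
  let i : Fin n := ⟨0, by omega⟩
  have hA := perturbed_isSymm hT G (β := β)
  set A := (T.distMatrix hT)⁻¹ - β • G.laplacian with hAdef
  set y := blockOf v i with hy
  have hwi : blockOf (v - constBlocks n y) i = 0 := by simp [hy]
  -- For `v` in the kernel, both sign conditions apply to the same number, which forces `y = 0`;
  -- then `v` vanishes in block `i` and strict negativity forces `v = 0`.
  have hform : (v - constBlocks n y) ⬝ᵥ (A *ᵥ (v - constBlocks n y)) =
      constBlocks n y ⬝ᵥ (A *ᵥ constBlocks n y) := by
    rw [Matrix.mulVec_sub, hv, zero_sub, dotProduct_neg, sub_dotProduct,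
      hA.dotProduct_mulVec_comm v (constBlocks n y), hv, dotProduct_zero]
    ring
  have hnonpos := perturbed_form_nonpos hT G hn hβ i _ hwi
  have hy0 : y = 0 := by
    by_contra hy0
    have := constBlocks_perturbed_form_pos hT G (β := β) hn y hy0
    linarith
  have hc : constBlocks n y = 0 := by rw [hy0]; rfl
  by_contra hv0
  have := perturbed_form_neg hT hn hG hβ' i v hy0 hv0
  simp [← hAdef, hv] at this

end WeightedGraph

open WeightedGraph in
theorem theorem2p1 (n s : ℕ) (hn : 2 ≤ n)
    (T : WeightedGraph n s) (hT : T.graph.IsTree)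
    (G : WeightedGraph n s) (hG : G.graph.Connected) :
    IsUnit (T.distMatrix hT) ∧
    (∀ β : ℝ, 0 ≤ β →
      IsUnit ((T.distMatrix hT)⁻¹ - β • G.laplacian) ∧
      ((T.distMatrix hT)⁻¹ - β • G.laplacian).IsSymm ∧
      inertia ((T.distMatrix hT)⁻¹ - β • G.laplacian) = (n * s - s, 0, s) ∧
      (∀ i : Fin n,
        (0 < β →
          (-principalBlocks ((T.distMatrix hT)⁻¹ - β • G.laplacian)
            (Finset.univ \ {i})).PosDef) ∧
        (-principalBlocks ((T.distMatrix hT)⁻¹ - β • G.laplacian)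
          (Finset.univ \ {i})).PosSemidef) ∧
      IsUnit (Matrix.fromBlocks ((T.distMatrix hT)⁻¹ - β • G.laplacian)⁻¹ (blockOnes n s)
        (blockOnes n s)ᵀ 0) ∧
      numPosEigenvalues (Matrix.fromBlocks ((T.distMatrix hT)⁻¹ - β • G.laplacian)⁻¹
        (blockOnes n s) (blockOnes n s)ᵀ 0) = s ∧
      (∀ x : Fin n × Fin s → ℝ, blockJ n s *ᵥ x = 0 →
        x ⬝ᵥ (((T.distMatrix hT)⁻¹ - β • G.laplacian)⁻¹ *ᵥ x) ≤ 0)) ∧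
    (∀ i j : Fin n, IsPosDefForm (blockAt ((T.distMatrix hT)⁻¹ - G.laplacian)⁻¹ i j)) := by
  let i₀ : Fin n := ⟨0, by omega⟩
  refine ⟨isUnit_distMatrix hT hn, fun β hβ => ?_, fun i j => ?_⟩
  · have hu := isUnit_perturbed hT hn hG hβ
    have hA := perturbed_isSymm hT G (β := β)
    have hpos := constBlocks_perturbed_form_pos hT G (β := β) hn
    have hneg := perturbed_form_nonpos hT G hn hβ
    refine ⟨hu, hA, inertia_eq hA hpos hneg hu i₀, fun i => ⟨fun hβ' => ?_, ?_⟩,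
      isUnit_bordered hpos hu, numPosEigenvalues_bordered hA hpos hneg hu i₀, fun x hx => ?_⟩
    · refine .of_dotProduct_mulVec_pos (principalBlocks_isSymm hA _).isHermitian_real.neg
        fun w hw => ?_
      rw [star_trivial, Matrix.neg_mulVec, dotProduct_neg, principalBlocks_form, neg_pos]
      exact perturbed_form_neg hT hn hG hβ' i _ (blockOf_extendBlocks (by simp) w)
        ((map_ne_zero_iff _ (extendBlocks_injective _)).2 hw)
    · refine .of_dotProduct_mulVec_nonneg (principalBlocks_isSymm hA _).isHermitian_real.neg
        fun w => ?_
      rw [star_trivial, Matrix.neg_mulVec, dotProduct_neg, principalBlocks_form, neg_nonneg]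
      exact hneg i _ (blockOf_extendBlocks (by simp) w)
    · refine inv_form_nonpos hA hpos hneg hu i₀ ?_
      rw [blockJ_mulVec] at hx
      exact congrArg (blockOf · i₀) hx
  · have h := inv_block_isPosDefForm (perturbed_isSymm hT G (β := 1))
      (constBlocks_perturbed_form_pos hT G hn) (perturbed_form_nonpos hT G hn zero_le_one)
      (isUnit_perturbed hT hn hG zero_le_one) (perturbed_form_neg hT hn hG one_pos) i j
    rwa [one_smul] at h
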